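/- For $\rho>0$ let $\mathcal D_\rho(0)\subset\mathbb C$ be the open disk of radius $\rho$ centred at $0$. For $k\in\mathbb N$ let $\mathcal V(k,\rho)$ be the set of functions $f$ holomorphic on $\mathcal D_\rho(0)$ for which there is a non-zero polynomial $S\in\mathbb C[z,w]$ of (total) degree at most $k$ such that $S(z,f(z))=0$ for all $z\in\mathcal D_\rho(0)$ and such that $\{(z,w)\in\mathbb C^2: S(z,w)=0\}\cap(\mathcal D_\rho(0)\times\mathbb C)$ is the union of at most $k$ elements, each of which is either a vertical line $\{(z,w)\in\mathbb C^2: z=z_*\}$ or one of a family of pairwise disjoint graphs of holomorphic functions over $\mathcal D_\rho(0)$. Let $\mathcal V_0(k,\rho)$ be the set of those $g\in\mathcal V(k,\rho)$ with $g(0)=0$. For a compact $\mathcal K\subset\mathcal D_\rho(0)$ and $M\ge 0$ let $\mathcal U(k,\rho,\mathcal K,M)$ be the set of those $g\in\mathcal V_0(k,\rho)$ with $\max_{\mathcal K}|g|=M$. **Theorem.** Let $k\in\mathbb N$ and let $\mathcal K\subset\mathbb C$ be a compact set with $\operatorname{card}\mathcal K>k$. 1. For every $\rho>1$ with $\mathcal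 K\subset\mathcal D_\rho(0)$ there is a constant $K=K(k,\rho,\mathcal K)>0$ such that for every $M\ge 0$ and every $g\in\mathcal U(k,\rho,\mathcal K,M)$ the coefficients of the Taylor series $g(z)=\sum_{j\ge 1}a_jz^j$ at $0$ satisfy $$|a_j|\le K(k,\rho,\mathcal K)\,M\qquad\text{for all } j.$$ 2. For every $m>1$ there is a constant $K=K(k,m,\mathcal K)>0$ such that for every $0<\rho\le 1$ with $\mathcal K\subset\mathcal D_\rho(0)$, every $M\ge 0$ and every $g\in\mathcal U(k,\rho,\mathcal K,M)$, the Taylor coefficients of $g$ at $0$ satisfy $$|a_j|\le K(k,m,\mathcal K)\,M\left(\frac m\rho\right)^j\qquad\text{for all } j.$$ -/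

import Mathlib

open Metric Set

namespace NashFun

/-- The algebraic curve `{(z, w) ∈ ℂ² : S(z, w) = 0}` of a polynomial `S ∈ ℂ[z, w]`; the variable
of index `0` is `z`, the variable of index `1` is `w`. -/
def curve (S : MvPolynomial (Fin 2) ℂ) : Set (ℂ × ℂ) :=
  {p | MvPolynomial.eval ![p.1, p.2] S = 0}

/-- The vertical line `{(z, w) ∈ ℂ² : z = c}`. -/
def verticalLine (c : ℂ) : Set (ℂ × ℂ) := {p | p.1 = c}

/-- The graph over the open disk of radius `ρ` centred at the origin of a function `h`. -/
def diskGraph (ρ : ℝ) (h : ℂ → ℂ) : Set (ℂ × ℂ) :=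
  {p | p.1 ∈ ball (0 : ℂ) ρ ∧ p.2 = h p.1}

/-- Over the open disk of radius `ρ`, the curve of `S` is the union of at most `k` elements, each
of which is either a vertical line or one of a family of pairwise disjoint graphs of functions
holomorphic on the disk. -/
def SplitsOverDisk (k : ℕ) (ρ : ℝ) (S : MvPolynomial (Fin 2) ℂ) : Prop :=
  ∃ (p q : ℕ) (c : Fin p → ℂ) (h : Fin q → ℂ → ℂ),
    p + q ≤ k ∧
    (∀ i, DifferentiableOn ℂ (h i) (ball 0 ρ)) ∧
    (∀ i j, i ≠ j → Disjoint (diskGraph ρ (h i)) (diskGraph ρ (h j))) ∧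
    curve S ∩ (ball (0 : ℂ) ρ ×ˢ univ) =
      (⋃ i, verticalLine (c i)) ∪ ⋃ i, diskGraph ρ (h i)

/-- The class `𝒱(k, ρ)`. Functions on the disk are represented by functions on `ℂ`, whose values
outside the disk are irrelevant. -/
def V (k : ℕ) (ρ : ℝ) : Set (ℂ → ℂ) :=
  {f | DifferentiableOn ℂ f (ball 0 ρ) ∧
    ∃ S : MvPolynomial (Fin 2) ℂ, S ≠ 0 ∧ S.totalDegree ≤ k ∧
      diskGraph ρ f ⊆ curve S ∧ SplitsOverDisk k ρ S}

/-- The class `𝒱₀(k, ρ)`: the functions of `𝒱(k, ρ)` that vanish at the origin. -/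
def V₀ (k : ℕ) (ρ : ℝ) : Set (ℂ → ℂ) := {g | g ∈ V k ρ ∧ g 0 = 0}

/-- The class `𝒰(k, ρ, 𝒦, M)`: the functions `g` of `𝒱₀(k, ρ)` with `max_𝒦 |g| = M`. -/
def U (k : ℕ) (ρ : ℝ) (𝒦 : Set ℂ) (M : ℝ) : Set (ℂ → ℂ) :=
  {g | g ∈ V₀ k ρ ∧ IsGreatest ((fun z => ‖g z‖) '' 𝒦) M}

/-- The `j`-th Taylor coefficient of `g` at the origin. -/
noncomputable def taylorCoeff (g : ℂ → ℂ) (j : ℕ) : ℂ :=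
  iteratedDeriv j g 0 / (Nat.factorial j : ℂ)

end NashFun

open Filter Topology

namespace NashFun

/-! Scaling `z` by `ρ` and `w` by a value of `|g|` reduces everything to one claim on the unit disk:
a branch of modulus at least `1` somewhere on `|z| ≤ r < 1` cannot be arbitrarily small at `k + 1`
separated points. Cauchy's estimates then bound the coefficients.

The claim (`exists_forall_exists_le_norm`) is proved by compactness. Coefficient matrices of norm
`1` along a sequence of counterexamples subconverge to a non-zero `C`. The polynomial `C(z, 0)` has
degree at most `k` and `k + 1` distinct zeros, so the limit curve contains the line `w = 0`. Choose
a torus `|z| = s`, `|w| = η` with `r < s < 1`, `η < 1` that misses the limit curve. Nearby curves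
miss it too and have a branch `h` with `|h| < η` on `|z| = s`. If `|g| > η` on that circle, a Rouché
argument with `g 0 = 0` makes `g` and `h` meet; disjointness of the graphs forces `g = h`, which is
absurd. So `|g| ≤ η < 1` inside (`IsSplitBranch.norm_lt`), a contradiction. -/

/-- The polynomial function of two variables with the coefficient matrix `A`. -/
noncomputable def bipoly {n : ℕ} (A : Fin n → Fin n → ℂ) (z w : ℂ) : ℂ :=
  ∑ j, (∑ i, A i j * z ^ (i : ℕ)) * w ^ (j : ℕ)

theorem continuous_bipoly {n : ℕ} :
    Continuous fun x : (Fin n → Fin n → ℂ) × ℂ × ℂ => bipoly x.1 x.2.1 x.2.2 := by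
  unfold bipoly
  fun_prop

theorem bipoly_smul {n : ℕ} (a : ℂ) (A : Fin n → Fin n → ℂ) (z w : ℂ) :
    bipoly (a • A) z w = a * bipoly A z w := by
  simp only [bipoly, Pi.smul_apply, smul_eq_mul, Finset.mul_sum, Finset.sum_mul, mul_assoc]

theorem bipoly_mul_mul {n : ℕ} (A : Fin n → Fin n → ℂ) (a b z w : ℂ) :
    bipoly A (a * z) (b * w) =
      bipoly (fun i j => A i j * a ^ (i : ℕ) * b ^ (j : ℕ)) z w := by
  simp only [bipoly, Finset.sum_mul]
  refine Finset.sum_congr rfl fun j _ => Finset.sum_congr rfl fun i _ => ?_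
  rw [mul_pow, mul_pow]
  ring

/-- A polynomial of total degree at most `k` is given by a square matrix of size `k + 1`. -/
theorem exists_bipoly_eq_eval {k : ℕ} {S : MvPolynomial (Fin 2) ℂ} (hS : S ≠ 0)
    (hdeg : S.totalDegree ≤ k) :
    ∃ A : Fin (k + 1) → Fin (k + 1) → ℂ, A ≠ 0 ∧
      ∀ z w, bipoly A z w = MvPolynomial.eval ![z, w] S := by
  let e : ℕ × ℕ → (Fin 2 →₀ ℕ) := fun x => Finsupp.equivFunOnFinite.symm ![x.1, x.2]
  have he0 : ∀ x, e x 0 = x.1 := fun x => rfl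
  have he1 : ∀ x, e x 1 = x.2 := fun x => rfl
  have hinj : Function.Injective fun x : Fin (k + 1) × Fin (k + 1) => e (x.1, x.2) := by
    intro x y hxy
    have h0 := DFunLike.congr_fun hxy 0
    have h1 := DFunLike.congr_fun hxy 1
    simp only [he0, he1] at h0 h1
    exact Prod.ext (Fin.ext h0) (Fin.ext h1)
  have hle : ∀ d ∈ S.support, ∀ i, d i < k + 1 := fun d hd i =>
    Nat.lt_succ_of_le ((MvPolynomial.monomial_le_degreeOf i hd).trans
      ((MvPolynomial.degreeOf_le_totalDegree S i).trans hdeg))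
  have hsurj : ∀ d : Fin 2 →₀ ℕ, e (d 0, d 1) = d := by
    intro d
    ext i
    fin_cases i <;> rfl
  refine ⟨fun i j => S.coeff (e (i, j)), ?_, fun z w => ?_⟩
  · intro h
    apply hS
    ext d
    by_cases hd : d ∈ S.support
    · have := congrFun (congrFun h ⟨d 0, hle d hd 0⟩) ⟨d 1, hle d hd 1⟩
      simpa [hsurj] using this
    · simpa using hd
  · rw [MvPolynomial.eval_eq']
    have hsub : S.support ⊆ Finset.univ.map ⟨_, hinj⟩ := by
      intro d hd
      rw [Finset.mem_map]
      exact ⟨(⟨d 0, hle d hd 0⟩, ⟨d 1, hle d hd 1⟩), Finset.mem_univ _, hsurj d⟩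
    rw [Finset.sum_subset hsub (fun d _ hd => by simp [MvPolynomial.notMem_support_iff.1 hd]),
      Finset.sum_map, Fintype.sum_prod_type, Finset.sum_comm]
    simp only [bipoly, Finset.sum_mul]
    refine Finset.sum_congr rfl fun j _ => Finset.sum_congr rfl fun i _ => ?_
    simp [Fin.prod_univ_two, he0, he1, mul_assoc]

/-! ### Consequences of the maximum principle and of connectedness -/

/-- A polynomial in `w` which is small at `0` and bounded below on a circle around `0` has a root
inside that circle. -/
theorem exists_root_of_norm_lt {p : ℂ → ℂ} (hp : Differentiable ℂ p) {η c : ℝ} (hη : 0 < η)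
    (hc : ∀ w ∈ sphere (0 : ℂ) η, c ≤ ‖p w‖) (h0 : ‖p 0‖ < c) :
    ∃ w ∈ ball (0 : ℂ) η, p w = 0 := by
  by_contra! hne
  have hc0 : 0 < c := (norm_nonneg _).trans_lt h0
  have hne' : ∀ w ∈ closedBall (0 : ℂ) η, p w ≠ 0 := by
    intro w hw
    rcases (mem_closedBall.1 hw).lt_or_eq with h | h
    · exact hne w h
    · intro h'
      have := hc w h
      rw [h', norm_zero] at this
      linarith
  -- Maximum principle for `1 / p`: at most `1 / c` on the circle, yet larger at `0`.
  have hd : DiffContOnCl ℂ (fun w => (p w)⁻¹) (ball 0 η) := by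
    apply DifferentiableOn.diffContOnCl
    rw [closure_ball _ hη.ne']
    exact hp.differentiableOn.inv hne'
  have := Complex.norm_le_of_forall_mem_frontier_norm_le isBounded_ball hd (C := c⁻¹)
    (fun w hw => by
      rw [frontier_ball _ hη.ne'] at hw
      rw [norm_inv]
      exact inv_anti₀ hc0 (hc w hw)) (subset_closure (mem_ball_self hη))
  rw [norm_inv, inv_le_inv₀ (norm_pos_iff.2 (hne 0 (mem_ball_self hη))) hc0] at this
  linarith

/-- On a circle, a continuous function whose norm avoids `η` has norm everywhere below `η` as soon
as it has norm below `η` somewhere. -/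
theorem norm_lt_of_norm_ne_on_sphere {f : ℂ → ℂ} {s η : ℝ} (hf : ContinuousOn f (sphere 0 s))
    (hne : ∀ z ∈ sphere (0 : ℂ) s, ‖f z‖ ≠ η) {z₀ : ℂ} (hz₀ : z₀ ∈ sphere (0 : ℂ) s)
    (h₀ : ‖f z₀‖ < η) : ∀ z ∈ sphere (0 : ℂ) s, ‖f z‖ < η := by
  intro z hz
  by_contra! hle
  have hpre : IsPreconnected (sphere (0 : ℂ) s) :=
    isPreconnected_sphere (by rw [Complex.rank_real_complex]; norm_num) _ _
  obtain ⟨x, hx, hxη⟩ := hpre.intermediate_value hz₀ hz hf.norm ⟨h₀.le, hle⟩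
  exact hne x hx hxη

/-- If `h` is smaller than `g` on a circle and `g` vanishes at the centre, then `g` and `h` agree
somewhere inside. -/
theorem exists_eq_of_norm_lt_on_sphere {g h : ℂ → ℂ} {s : ℝ} (hs : 0 < s)
    (hg : DifferentiableOn ℂ g (closedBall 0 s)) (hh : DifferentiableOn ℂ h (closedBall 0 s))
    (hlt : ∀ z ∈ sphere (0 : ℂ) s, ‖h z‖ < ‖g z‖) (h0 : g 0 = 0) :
    ∃ z ∈ closedBall (0 : ℂ) s, g z = h z := by
  by_contra! hne
  have hne' : ∀ z ∈ closedBall (0 : ℂ) s, g z - h z ≠ 0 := fun z hz => sub_ne_zero.2 (hne z hz)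
  -- In place of counting zeros: `|h| < |g|` on the circle means `Re (g / (g - h)) > 1 / 2` there,
  -- so the exponential has modulus at most `exp (-1 / 2)`, whereas at the centre it equals `1`.
  have hd : DiffContOnCl ℂ (fun z => Complex.exp (-(g z / (g z - h z)))) (ball 0 s) := by
    apply DifferentiableOn.diffContOnCl
    rw [closure_ball _ hs.ne']
    exact ((hg.div (hg.sub hh) hne').neg).cexp
  have := Complex.norm_le_of_forall_mem_frontier_norm_le isBounded_ball hd
    (C := Real.exp (-(1 / 2))) (fun z hz => by
      rw [frontier_ball _ hs.ne'] at hz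
      rw [Complex.norm_exp, Real.exp_le_exp, Complex.neg_re, neg_le_neg_iff]
      have hn := hne' z (sphere_subset_closedBall hz)
      have hpos : 0 < Complex.normSq (g z - h z) := Complex.normSq_pos.2 hn
      have hsq : ‖h z‖ ^ 2 < ‖g z‖ ^ 2 :=
        pow_lt_pow_left₀ (hlt z hz) (norm_nonneg _) two_ne_zero
      rw [← Complex.normSq_eq_norm_sq, ← Complex.normSq_eq_norm_sq] at hsq
      rw [Complex.div_re, ← add_div, le_div_iff₀ hpos]
      simp only [Complex.normSq_apply, Complex.sub_re, Complex.sub_im] at hsq ⊢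
      nlinarith) (subset_closure (mem_ball_self hs))
  rw [h0, zero_div, neg_zero, Complex.exp_zero, norm_one, Real.one_le_exp_iff] at this
  linarith

/-! ### Split branches -/

/-- `g` is a holomorphic solution of `bipoly A z (g z) = 0` on the disk of radius `ρ`, with
`g 0 = 0`, and through every point of the curve, vertical lines excluded, passes the graph of a
holomorphic solution which either coincides with `g` or never meets it. -/
structure IsSplitBranch {n : ℕ} (A : Fin n → Fin n → ℂ) (ρ : ℝ) (g : ℂ → ℂ) : Prop where
  differentiableOn : DifferentiableOn ℂ g (ball 0 ρ)
  map_zero : g 0 = 0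
  bipoly_eq_zero : ∀ z ∈ ball (0 : ℂ) ρ, bipoly A z (g z) = 0
  exists_branch : ∀ z ∈ ball (0 : ℂ) ρ, ∀ w, bipoly A z w = 0 → (∃ w', bipoly A z w' ≠ 0) →
    ∃ h : ℂ → ℂ, DifferentiableOn ℂ h (ball 0 ρ) ∧ (∀ x ∈ ball (0 : ℂ) ρ, bipoly A x (h x) = 0) ∧
      h z = w ∧ ((∀ x ∈ ball (0 : ℂ) ρ, h x = g x) ∨ ∀ x ∈ ball (0 : ℂ) ρ, h x ≠ g x)

theorem IsSplitBranch.smul {n : ℕ} {A : Fin n → Fin n → ℂ} {ρ : ℝ} {g : ℂ → ℂ}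
    (hg : IsSplitBranch A ρ g) {a : ℂ} (ha : a ≠ 0) : IsSplitBranch (a • A) ρ g := by
  constructor
  · exact hg.differentiableOn
  · exact hg.map_zero
  · intro z hz
    rw [bipoly_smul, hg.bipoly_eq_zero z hz, mul_zero]
  · simpa only [bipoly_smul, mul_eq_zero, ha, false_or, ne_eq] using hg.exists_branch

/-- This normalisation makes the final bound linear in `M` and lets one compactness argument serve
all radii `ρ`. -/
theorem IsSplitBranch.rescale {n : ℕ} {A : Fin n → Fin n → ℂ} {ρ W : ℝ} {g : ℂ → ℂ}
    (hg : IsSplitBranch A ρ g) (hρ : 0 < ρ) (hW : 0 < W) :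
    IsSplitBranch (fun i j => A i j * (ρ : ℂ) ^ (i : ℕ) * (W : ℂ) ^ (j : ℕ)) 1
      (fun z => g (ρ * z) / W) := by
  have hWC : (W : ℂ) ≠ 0 := by exact_mod_cast hW.ne'
  have hmaps : ∀ z ∈ ball (0 : ℂ) 1, (ρ : ℂ) * z ∈ ball (0 : ℂ) ρ := by
    intro z hz
    rw [mem_ball_zero_iff] at hz ⊢
    rw [norm_mul, Complex.norm_real, Real.norm_of_nonneg hρ.le]
    nlinarith
  have hdiff : ∀ h : ℂ → ℂ, DifferentiableOn ℂ h (ball 0 ρ) →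
      DifferentiableOn ℂ (fun z => h (ρ * z) / W) (ball 0 1) := fun h hh =>
    (hh.comp (by fun_prop) hmaps).div_const _
  constructor
  · exact hdiff g hg.differentiableOn
  · simp [hg.map_zero]
  · intro z hz
    rw [← bipoly_mul_mul, mul_div_cancel₀ _ hWC]
    exact hg.bipoly_eq_zero _ (hmaps z hz)
  · rintro z hz w hw ⟨w', hw'⟩
    rw [← bipoly_mul_mul] at hw hw'
    obtain ⟨h, hd, hroot, hzw, hor⟩ := hg.exists_branch _ (hmaps z hz) _ hw ⟨_, hw'⟩
    refine ⟨fun z => h (ρ * z) / W, hdiff h hd, fun x hx => ?_, ?_, ?_⟩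
    · rw [← bipoly_mul_mul, mul_div_cancel₀ _ hWC]
      exact hroot _ (hmaps x hx)
    · simp only [hzw]
      field_simp
    · refine hor.imp (fun H x hx => ?_) (fun H x hx hx' => ?_)
      · simp only [H _ (hmaps x hx)]
      · exact H _ (hmaps x hx) ((div_left_inj' hWC).1 hx')

/-- If the curve avoids `‖z‖ = s`, `‖w‖ = η` and is close to the origin over `z = s`, then `g` is
bounded by `η` on the disk of radius `s`. -/
theorem IsSplitBranch.norm_lt {n : ℕ} {A : Fin n → Fin n → ℂ} {ρ s η c : ℝ} {g : ℂ → ℂ}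
    (hg : IsSplitBranch A ρ g) (hs : 0 < s) (hsρ : s < ρ) (hη : 0 < η)
    (hA : ∀ z ∈ sphere (0 : ℂ) s, ∀ w ∈ sphere (0 : ℂ) η, c < ‖bipoly A z w‖)
    (hA0 : ‖bipoly A s 0‖ < c) : ∀ z ∈ closedBall (0 : ℂ) s, ‖g z‖ ≤ η := by
  have hsub : closedBall (0 : ℂ) s ⊆ ball 0 ρ := closedBall_subset_ball hsρ
  have hsub' : sphere (0 : ℂ) s ⊆ ball 0 ρ := sphere_subset_closedBall.trans hsub
  have hc : 0 < c := (norm_nonneg _).trans_lt hA0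
  have hsmem : (s : ℂ) ∈ sphere (0 : ℂ) s := by
    simp [hs.le]
  have hηmem : (η : ℂ) ∈ sphere (0 : ℂ) η := by
    simp [hη.le]
  have havoid : ∀ f : ℂ → ℂ, (∀ x ∈ ball (0 : ℂ) ρ, bipoly A x (f x) = 0) →
      ∀ z ∈ sphere (0 : ℂ) s, ‖f z‖ ≠ η := by
    intro f hf z hz hzη
    have := hA z hz (f z) (by simpa using hzη)
    rw [hf z (hsub' hz), norm_zero] at this
    linarith
  obtain ⟨w, hw, hw0⟩ := exists_root_of_norm_lt (p := fun w => bipoly A s w)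
    (by unfold bipoly; fun_prop) hη (fun w hw => (hA s hsmem w hw).le) hA0
  -- The value `w' = η` certifies that the line `z = s` is not part of the curve.
  obtain ⟨h, hd, hroot, hsw, hor⟩ := hg.exists_branch s (hsub' hsmem) w hw0
    ⟨η, norm_pos_iff.1 (hc.trans (hA s hsmem η hηmem))⟩
  have hhlt : ∀ z ∈ sphere (0 : ℂ) s, ‖h z‖ < η :=
    norm_lt_of_norm_ne_on_sphere (hd.continuousOn.mono hsub') (havoid h hroot) hsmem
      (by rw [hsw]; simpa using hw)
  have hgs : ∀ z ∈ sphere (0 : ℂ) s, ‖g z‖ ≤ η := by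
    by_contra! hex
    obtain ⟨z₁, hz₁, hz₁η⟩ := hex
    have hglt : ∀ z ∈ sphere (0 : ℂ) s, η < ‖g z‖ := by
      intro z hz
      by_contra! hle
      have := norm_lt_of_norm_ne_on_sphere (hg.differentiableOn.continuousOn.mono hsub')
        (havoid g hg.bipoly_eq_zero) hz (hle.lt_of_ne (havoid g hg.bipoly_eq_zero z hz)) z₁ hz₁
      linarith
    obtain ⟨z, hz, hgh⟩ := exists_eq_of_norm_lt_on_sphere hs (hg.differentiableOn.mono hsub)
      (hd.mono hsub) (fun z hz => (hhlt z hz).trans (hglt z hz)) hg.map_zero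
    rcases hor with H | H
    · have h1 := hhlt z₁ hz₁
      rw [H z₁ (hsub' hz₁)] at h1
      linarith
    · exact H z (hsub hz) hgh.symm
  intro z hz
  refine Complex.norm_le_of_forall_mem_frontier_norm_le (U := ball 0 s) isBounded_ball ?_
    (fun z hz => hgs z (by rwa [frontier_ball _ hs.ne'] at hz)) (by rwa [closure_ball _ hs.ne'])
  apply DifferentiableOn.diffContOnCl
  rw [closure_ball _ hs.ne']
  exact hg.differentiableOn.mono hsub

/-! ### Tori off the curve and the compactness argument -/

/-- The roots have only finitely many moduli, and an open interval is infinite. -/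
theorem exists_radius_forall_sum_ne_zero {n : ℕ} {b : Fin n → ℂ} (hb : b ≠ 0) {r r' : ℝ}
    (hr : r < r') : ∃ s ∈ Ioo r r', ∀ z ∈ sphere (0 : ℂ) s, ∑ i, b i * z ^ (i : ℕ) ≠ 0 := by
  have hp : (∑ i : Fin n, Polynomial.monomial (i : ℕ) (b i)) ≠ 0 := by
    intro h
    apply hb
    funext i
    have := congrArg (fun p => Polynomial.coeff p (i : ℕ)) h
    simpa [Polynomial.finsetSum_coeff, Polynomial.coeff_monomial, Fin.val_inj] using this
  have hfin : ((fun z : ℂ => ‖z‖) ''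
      {z | (∑ i : Fin n, Polynomial.monomial (i : ℕ) (b i)).IsRoot z}).Finite :=
    (Polynomial.finite_setOfPred_isRoot hp).image _
  obtain ⟨s, hs, hns⟩ := (Ioo_infinite hr).exists_notMem_finite hfin
  refine ⟨s, hs, fun z hz h => hns ⟨z, ?_, by simpa using hz⟩⟩
  simpa [Polynomial.IsRoot, Polynomial.eval_finsetSum] using h

/-- A non-zero polynomial vanishes nowhere on a suitable torus with radii in prescribed
intervals. -/
theorem exists_torus_forall_bipoly_ne_zero {n : ℕ} {A : Fin n → Fin n → ℂ} (hA : A ≠ 0)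
    {r r' : ℝ} (hr : r < r') : ∃ s ∈ Ioo r r', ∃ η ∈ Ioo (0 : ℝ) 1,
      ∀ z ∈ sphere (0 : ℂ) s, ∀ w ∈ sphere (0 : ℂ) η, bipoly A z w ≠ 0 := by
  -- The least such `m` is the largest power of `w` dividing the polynomial. The quotient `T` is
  -- non-zero at `w = 0` over a suitable circle, hence, by compactness of the circle, for all small
  -- `w`.
  have hex : ∃ m : ℕ, ∃ hm : m < n, (fun i => A i ⟨m, hm⟩) ≠ 0 := by
    by_contra! h
    exact hA (funext fun i => funext fun j => congrFun (h j j.2) i)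
  classical
  obtain ⟨hm, hb⟩ := Nat.find_spec hex
  have hmin : ∀ j : Fin n, (j : ℕ) < Nat.find hex → ∀ i, A i j = 0 := by
    intro j hj i
    have := Nat.find_min hex hj
    push Not at this
    exact congrFun (this j.2) i
  set m := Nat.find hex with hmdef
  obtain ⟨s, hs, hsne⟩ := exists_radius_forall_sum_ne_zero hb hr
  let T : ℂ → ℂ → ℂ := fun w z =>
    ∑ j : Fin n, if m ≤ (j : ℕ) then (∑ i, A i j * z ^ (i : ℕ)) * w ^ ((j : ℕ) - m) else 0
  have hTcont : Continuous fun x : ℂ × ℂ => T x.1 x.2 := by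
    refine continuous_finsetSum _ fun j _ => ?_
    split_ifs <;> fun_prop
  have hT0 : ∀ z, T 0 z = ∑ i, A i ⟨m, hm⟩ * z ^ (i : ℕ) := by
    intro z
    refine (Finset.sum_eq_single ⟨m, hm⟩ (fun j _ hj => ?_) (by simp)).trans (by simp)
    split_ifs with h
    · have : (j : ℕ) - m ≠ 0 := by
        have : (j : ℕ) ≠ m := fun h' => hj (Fin.ext h')
        omega
      simp [this]
    · rfl
  have hTmul : ∀ z w, bipoly A z w = w ^ m * T w z := by
    intro z w
    simp only [T, bipoly, Finset.mul_sum]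
    refine Finset.sum_congr rfl fun j _ => ?_
    split_ifs with h
    · rw [mul_left_comm, ← pow_add, Nat.add_sub_cancel' h]
    · simp [hmin j (not_le.1 h)]
  have hev : ∀ᶠ w in 𝓝 (0 : ℂ), ∀ z ∈ sphere (0 : ℂ) s, T w z ≠ 0 :=
    (isCompact_sphere _ _).eventually_forall_of_forall_eventually fun z hz =>
      hTcont.continuousAt.eventually_ne (by rw [hT0]; exact hsne z hz)
  obtain ⟨ε, hε, hball⟩ := Metric.eventually_nhds_iff_ball.1 hev
  refine ⟨s, hs, min (ε / 2) (1 / 2), ⟨by positivity, ?_⟩, fun z hz w hw => ?_⟩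
  · exact (min_le_right _ _).trans_lt (by norm_num)
  · have hw' : ‖w‖ = min (ε / 2) (1 / 2) := by simpa using hw
    have hwpos : 0 < ‖w‖ := by rw [hw']; positivity
    rw [hTmul]
    refine mul_ne_zero (pow_ne_zero _ (norm_pos_iff.1 hwpos)) (hball w ?_ z hz)
    rw [mem_ball_zero_iff, hw']
    exact (min_le_left _ _).trans_lt (by linarith)

/-- The compactness step: if the curve of `A` contains the line `w = 0`, then the split branches
of the curves of nearby coefficient matrices are small on a given smaller disk. -/
theorem eventually_norm_lt_one {n : ℕ} {A : Fin n → Fin n → ℂ} (hA : A ≠ 0)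
    (hA0 : ∀ z, bipoly A z 0 = 0) {r : ℝ} (hr0 : 0 < r) (hr : r < 1) :
    ∀ᶠ B in 𝓝 A, ∀ g, IsSplitBranch B 1 g → ∀ z ∈ closedBall (0 : ℂ) r, ‖g z‖ < 1 := by
  obtain ⟨s, hs, η, hη, hne⟩ := exists_torus_forall_bipoly_ne_zero hA hr
  have hcomp : IsCompact (sphere (0 : ℂ) s ×ˢ sphere (0 : ℂ) η) :=
    (isCompact_sphere _ _).prod (isCompact_sphere _ _)
  have hcont : ContinuousOn (fun x : ℂ × ℂ => ‖bipoly A x.1 x.2‖)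
      (sphere (0 : ℂ) s ×ˢ sphere (0 : ℂ) η) :=
    (continuous_bipoly.comp (Continuous.prodMk_right A)).norm.continuousOn
  obtain ⟨c, hc, hle⟩ := hcomp.exists_forall_le' hcont (a := 0)
    fun x hx => norm_pos_iff.2 (hne x.1 hx.1 x.2 hx.2)
  have h1 : ∀ᶠ B in 𝓝 A, ∀ x ∈ sphere (0 : ℂ) s ×ˢ sphere (0 : ℂ) η,
      c / 2 < ‖bipoly B x.1 x.2‖ :=
    hcomp.eventually_forall_of_forall_eventually fun x hx =>
      continuous_bipoly.norm.continuousAt.eventually_const_lt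
        ((half_lt_self hc).trans_le (hle x hx))
  have h2 : ∀ᶠ B in 𝓝 A, ‖bipoly B s 0‖ < c / 2 := by
    have : Continuous fun B : Fin n → Fin n → ℂ => ‖bipoly B s 0‖ :=
      (continuous_bipoly.comp (Continuous.prodMk_left ((s : ℂ), (0 : ℂ)))).norm
    exact this.continuousAt.eventually_lt_const (by simpa only [hA0, norm_zero] using half_pos hc)
  filter_upwards [h1, h2] with B hB1 hB2 g hg z hz
  exact (hg.norm_lt (hr0.trans hs.1) hs.2 hη.1 (fun z hz w hw => hB1 (z, w) ⟨hz, hw⟩) hB2 z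
    (closedBall_subset_closedBall hs.1.le hz)).trans_lt hη.2

/-- A split branch on the unit disk which is not small on the disk of radius `r` is not small at
`n` separated points of the unit disk, with a uniform bound. -/
theorem exists_forall_exists_le_norm (n : ℕ) {r δ : ℝ} (hr0 : 0 < r) (hr : r < 1) (hδ : 0 < δ) :
    ∃ ε > 0, ∀ (A : Fin n → Fin n → ℂ) (g : ℂ → ℂ) (x : Fin n → ℂ), A ≠ 0 →
      IsSplitBranch A 1 g → (∀ i, x i ∈ ball (0 : ℂ) 1) → (∀ i j, i ≠ j → δ ≤ dist (x i) (x j)) →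
      (∃ z ∈ closedBall (0 : ℂ) r, 1 ≤ ‖g z‖) → ∃ i, ε ≤ ‖g (x i)‖ := by
  by_contra! hcon
  choose A g x hA hg hx hdist hz hlt using fun N : ℕ =>
    hcon (1 / ((N : ℝ) + 1)) Nat.one_div_pos_of_nat
  let B : ℕ → Fin n → Fin n → ℂ := fun N => ((‖A N‖⁻¹ : ℝ) : ℂ) • A N
  have hBs : ∀ N, IsSplitBranch (B N) 1 (g N) := fun N =>
    (hg N).smul (by simpa using hA N)
  have hB : ∀ N, (B N, x N) ∈
      sphere (0 : Fin n → Fin n → ℂ) 1 ×ˢ closedBall (0 : Fin n → ℂ) 1 := by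
    refine fun N => ⟨?_, ?_⟩
    · rw [mem_sphere_zero_iff_norm, norm_smul, Complex.norm_real, norm_inv, norm_norm,
        inv_mul_cancel₀ (norm_ne_zero_iff.2 (hA N))]
    · rw [mem_closedBall_zero_iff, pi_norm_le_iff_of_nonneg zero_le_one]
      exact fun i => (mem_ball_zero_iff.1 (hx N i)).le
  obtain ⟨⟨C, y⟩, hC, φ, hφ, hlim⟩ :=
    ((isCompact_sphere _ _).prod (isCompact_closedBall _ _)).tendsto_subseq hB
  have hCne : C ≠ 0 := by
    rintro rfl
    simpa using hC.1
  have hBlim : Tendsto (fun N => B (φ N)) atTop (𝓝 C) := (continuous_fst.tendsto _).comp hlim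
  have hxlim : ∀ i, Tendsto (fun N => x (φ N) i) atTop (𝓝 (y i)) := fun i =>
    (((continuous_apply i).comp continuous_snd).tendsto _).comp hlim
  -- The uniform separation `δ` keeps the limit points distinct.
  have hyinj : Function.Injective y := by
    intro i j hij
    by_contra hne
    have : δ ≤ dist (y i) (y j) :=
      ge_of_tendsto' ((hxlim i).dist (hxlim j)) fun N => hdist _ i j hne
    rw [hij, dist_self] at this
    linarith
  have hglim : ∀ i, Tendsto (fun N => g (φ N) (x (φ N) i)) atTop (𝓝 0) := fun i =>
    squeeze_zero_norm (fun N => (hlt (φ N) i).le)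
      (tendsto_one_div_add_atTop_nhds_zero_nat.comp hφ.tendsto_atTop)
  have hroot : ∀ i, bipoly C (y i) 0 = 0 := by
    intro i
    have hpt : Tendsto (fun N => (B (φ N), x (φ N) i, g (φ N) (x (φ N) i))) atTop
        (𝓝 (C, y i, 0)) := hBlim.prodMk_nhds ((hxlim i).prodMk_nhds (hglim i))
    have hev := (continuous_bipoly.tendsto (C, y i, (0 : ℂ))).comp hpt
    refine (tendsto_const_nhds_iff.1 (hev.congr fun N => ?_)).symm
    exact (hBs (φ N)).bipoly_eq_zero _ (hx (φ N) i)
  have hline : ∀ z, bipoly C z 0 = 0 := by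
    rcases n with _ | n
    · simp [bipoly]
    have hval : ∀ z, bipoly C z 0 = ∑ i : Fin (n + 1), z ^ (i : ℕ) * C i 0 := by
      intro z
      rw [bipoly, Finset.sum_eq_single 0 (fun j _ hj => by simp [Fin.val_eq_zero_iff, hj])
        (by simp)]
      simp [mul_comm]
    -- Vandermonde: as many distinct zeros as coefficients.
    have hzero := Matrix.eq_zero_of_forall_index_sum_pow_mul_eq_zero (v := fun i => C i 0) hyinj
      fun j => by rw [← hval]; exact hroot j
    intro z
    rw [hval]
    exact Finset.sum_eq_zero fun i _ => by rw [show C i 0 = 0 from congrFun hzero i, mul_zero]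
  obtain ⟨N, hN⟩ := (hBlim.eventually (eventually_norm_lt_one hCne hline hr0 hr)).exists
  obtain ⟨z, hzr, hz1⟩ := hz (φ N)
  exact (hN _ (hBs _) z hzr).not_ge hz1

/-! ### From `𝒱₀(k, ρ)` to Taylor coefficients -/

/-- The functions of the class `𝒱₀(k, ρ)` are split branches. -/
theorem exists_isSplitBranch {k : ℕ} {ρ : ℝ} (hρ : 0 < ρ) {g : ℂ → ℂ} (hg : g ∈ V₀ k ρ) :
    ∃ A : Fin (k + 1) → Fin (k + 1) → ℂ, A ≠ 0 ∧ IsSplitBranch A ρ g := by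
  obtain ⟨⟨hd, S, hS, hdeg, hgS, p, q, c, h, -, hh, hdisj, hcurve⟩, h0⟩ := hg
  obtain ⟨A, hA, hAS⟩ := exists_bipoly_eq_eval hS hdeg
  have hmem : ∀ z ∈ ball (0 : ℂ) ρ, ∀ w, bipoly A z w = 0 ↔
      (∃ i, z = c i) ∨ ∃ i, w = h i z := by
    intro z hz w
    have := Set.ext_iff.1 hcurve (z, w)
    rw [mem_ball_zero_iff] at hz
    simpa [curve, verticalLine, diskGraph, hz, ← hAS] using this
  have hroot : ∀ z ∈ ball (0 : ℂ) ρ, bipoly A z (g z) = 0 := by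
    intro z hz
    have : (z, g z) ∈ curve S := hgS ⟨hz, rfl⟩
    rw [hAS]
    exact this
  have hana : ∀ f : ℂ → ℂ, DifferentiableOn ℂ f (ball 0 ρ) → AnalyticOnNhd ℂ f (ball 0 ρ) :=
    fun f hf => hf.analyticOnNhd isOpen_ball
  -- Otherwise, by the identity theorem, `g` differs from every `h i` on a punctured neighbourhood
  -- of `0`. A point there off all the vertical lines contradicts the splitting of the curve.
  have hex : ∃ i, ∀ z ∈ ball (0 : ℂ) ρ, g z = h i z := by
    by_contra! hne
    have hev : ∀ i, ∀ᶠ z in 𝓝[≠] (0 : ℂ), g z ≠ h i z := by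
      intro i
      refine (AnalyticAt.eventually_eq_or_eventually_ne (hana g hd 0 (mem_ball_self hρ))
        (hana _ (hh i) 0 (mem_ball_self hρ))).resolve_left fun heq => ?_
      obtain ⟨z, hz, hzne⟩ := hne i
      exact hzne ((hana g hd).eqOn_of_preconnected_of_eventuallyEq (hana _ (hh i))
        (convex_ball _ _).isPreconnected (mem_ball_self hρ) heq hz)
    have hevc : ∀ i, ∀ᶠ z in 𝓝[≠] (0 : ℂ), z ≠ c i := by
      intro i
      by_cases hci : c i = 0
      · rw [hci]
        exact self_mem_nhdsWithin
      · exact (continuous_id.continuousAt.eventually_ne (Ne.symm hci)).filter_mono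
          nhdsWithin_le_nhds
    have hevb : ∀ᶠ z in 𝓝[≠] (0 : ℂ), z ∈ ball (0 : ℂ) ρ :=
      nhdsWithin_le_nhds (ball_mem_nhds _ hρ)
    obtain ⟨z, hz1, hz2, hz3⟩ :=
      ((eventually_all.2 hev).and ((eventually_all.2 hevc).and hevb)).exists
    rcases (hmem z hz3 _).1 (hroot z hz3) with ⟨i, hi⟩ | ⟨i, hi⟩
    · exact hz2 i hi
    · exact hz1 i hi
  obtain ⟨i₀, hi₀⟩ := hex
  refine ⟨A, hA, hd, h0, hroot, ?_⟩
  rintro z hz w hw ⟨w', hw'⟩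
  obtain ⟨j, hj⟩ : ∃ j, w = h j z :=
    ((hmem z hz w).1 hw).resolve_left fun hl => hw' ((hmem z hz w').2 (Or.inl hl))
  refine ⟨h j, hh j, fun x hx => (hmem x hx _).2 (Or.inr ⟨j, rfl⟩), hj.symm, ?_⟩
  by_cases hji : j = i₀
  · exact Or.inl fun x hx => by rw [hi₀ x hx, hji]
  · refine Or.inr fun x hx hxe => ?_
    have hmem₁ : (x, h j x) ∈ diskGraph ρ (h j) := ⟨hx, rfl⟩
    have hmem₂ : (x, h j x) ∈ diskGraph ρ (h i₀) := ⟨hx, hxe.trans (hi₀ x hx)⟩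
    exact Set.disjoint_left.1 (hdisj j i₀ hji) hmem₁ hmem₂

/-- Taylor coefficients in `𝒰(k, ρ, 𝒦, M)`, for sets `𝒦` containing `k + 1` points that are
`δ ρ`-separated. -/
theorem exists_norm_taylorCoeff_le (k : ℕ) {r δ : ℝ} (hr0 : 0 < r) (hr : r < 1) (hδ : 0 < δ) :
    ∃ K > 0, ∀ (ρ : ℝ) (𝒦 : Set ℂ) (x : Fin (k + 1) → ℂ), 0 < ρ → 𝒦 ⊆ ball (0 : ℂ) ρ →
      (∀ i, x i ∈ 𝒦) → (∀ i j, i ≠ j → δ * ρ ≤ dist (x i) (x j)) →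
      ∀ (M : ℝ) (g : ℂ → ℂ), g ∈ U k ρ 𝒦 M →
        ∀ j : ℕ, ‖taylorCoeff g j‖ ≤ K * M / (r * ρ) ^ j := by
  obtain ⟨ε, hε, H⟩ := exists_forall_exists_le_norm (k + 1) hr0 hr hδ
  refine ⟨ε⁻¹, inv_pos.2 hε, fun ρ 𝒦 x hρ h𝒦 hx hdist M g hg j => ?_⟩
  obtain ⟨A, hA, hgA⟩ := exists_isSplitBranch hρ hg.1
  have hM : ∀ z ∈ 𝒦, ‖g z‖ ≤ M := fun z hz => hg.2.2 ⟨z, hz, rfl⟩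
  have hM0 : 0 ≤ M := (norm_nonneg _).trans (hM _ (hx 0))
  have hρC : (ρ : ℂ) ≠ 0 := by exact_mod_cast hρ.ne'
  have hrρ : 0 < r * ρ := mul_pos hr0 hρ
  have hbound : ∀ z ∈ closedBall (0 : ℂ) (r * ρ), ‖g z‖ ≤ ε⁻¹ * M := by
    intro z hz
    rcases (norm_nonneg (g z)).eq_or_lt with h | hW
    · rw [← h]
      positivity
    -- With this `W` the rescaled branch has modulus exactly `1` at `z / ρ`, so it is at least `ε`
    -- at some `x i / ρ`; that is, `ε W ≤ M`.
    set W := ‖g z‖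
    have hWC : (W : ℂ) ≠ 0 := by exact_mod_cast hW.ne'
    have hA' : (fun i j : Fin (k + 1) => A i j * (ρ : ℂ) ^ (i : ℕ) * (W : ℂ) ^ (j : ℕ)) ≠ 0 := by
      intro h
      apply hA
      funext i j
      have := congrFun (congrFun h i) j
      simpa [hρC, hWC] using this
    obtain ⟨i, hi⟩ := H _ _ (fun i => x i / ρ) hA' (hgA.rescale hρ hW)
      (fun i => by
        have := mem_ball_zero_iff.1 (h𝒦 (hx i))
        rw [mem_ball_zero_iff, norm_div, Complex.norm_real, Real.norm_of_nonneg hρ.le]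
        exact (div_lt_one hρ).2 this)
      (fun i j hij => by
        rw [dist_eq_norm, ← sub_div, norm_div, Complex.norm_real, Real.norm_of_nonneg hρ.le,
          ← dist_eq_norm, le_div_iff₀ hρ]
        exact hdist i j hij)
      ⟨z / ρ, by
        rw [mem_closedBall_zero_iff] at hz ⊢
        rwa [norm_div, Complex.norm_real, Real.norm_of_nonneg hρ.le, div_le_iff₀ hρ], by
        rw [mul_div_cancel₀ _ hρC, norm_div, Complex.norm_real, Real.norm_of_nonneg hW.le]
        exact (div_self hW.ne').ge⟩
    rw [mul_div_cancel₀ _ hρC, norm_div, Complex.norm_real, Real.norm_of_nonneg hW.le,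
      le_div_iff₀ hW] at hi
    rw [inv_mul_eq_div, le_div_iff₀ hε]
    linarith [hM _ (hx i)]
  have hdc : DiffContOnCl ℂ g (ball 0 (r * ρ)) := by
    apply DifferentiableOn.diffContOnCl
    rw [closure_ball _ hrρ.ne']
    exact hgA.differentiableOn.mono (closedBall_subset_ball (by nlinarith))
  have := Complex.norm_iteratedDeriv_le_of_forall_mem_sphere_norm_le j hrρ hdc
    fun z hz => hbound z (sphere_subset_closedBall hz)
  have hfac : (0 : ℝ) < (j.factorial : ℝ) := by exact_mod_cast j.factorial_pos
  rw [taylorCoeff, norm_div, Complex.norm_natCast, div_le_iff₀ hfac]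
  calc _ ≤ _ := this
    _ = _ := by ring

/-- A set with more than `k` elements contains `k + 1` points separated by a positive distance. -/
theorem exists_separated_points {k : ℕ} {𝒦 : Set ℂ} (hcard : (k : ℕ∞) < 𝒦.encard) :
    ∃ x : Fin (k + 1) → ℂ, (∀ i, x i ∈ 𝒦) ∧
      ∃ δ > 0, ∀ i j, i ≠ j → δ ≤ dist (x i) (x j) := by
  obtain ⟨t, ht, htcard⟩ := Set.exists_subset_encard_eq (k := ((k + 1 : ℕ) : ℕ∞))
    (by push_cast; exact Order.add_one_le_of_lt hcard)
  have hfin : t.Finite := Set.finite_of_encard_eq_coe htcard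
  have hc : hfin.toFinset.card = k + 1 := by
    rw [hfin.encard_eq_coe_toFinset_card] at htcard
    exact_mod_cast htcard
  let e := (hfin.toFinset.equivFinOfCardEq hc).symm
  have hinj : Function.Injective fun i => (e i : ℂ) := Subtype.val_injective.comp e.injective
  refine ⟨fun i => e i, fun i => ht (hfin.mem_toFinset.1 (e i).2), ?_⟩
  have hev : ∀ᶠ δ in 𝓝[>] (0 : ℝ), ∀ i j, i ≠ j → δ ≤ dist (e i : ℂ) (e j) :=
    eventually_all.2 fun i => eventually_all.2 fun j => eventually_imp_distrib_left.2 fun hij =>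
      (eventually_le_nhds (dist_pos.2 (hinj.ne hij))).filter_mono nhdsWithin_le_nhds
  obtain ⟨δ, hle, hδ⟩ := (hev.and self_mem_nhdsWithin).exists
  exact ⟨δ, hδ, hle⟩

end NashFun

theorem mainTheorem3 (k : ℕ) (𝒦 : Set ℂ) (hcompact : IsCompact 𝒦)
    (hcard : (k : ℕ∞) < 𝒦.encard) :
    (∀ ρ : ℝ, 1 < ρ → 𝒦 ⊆ Metric.ball (0 : ℂ) ρ →
      ∃ K : ℝ, 0 < K ∧ ∀ (M : ℝ) (g : ℂ → ℂ), g ∈ NashFun.U k ρ 𝒦 M →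
        ∀ j : ℕ, ‖NashFun.taylorCoeff g j‖ ≤ K * M) ∧
    (∀ m : ℝ, 1 < m →
      ∃ K : ℝ, 0 < K ∧ ∀ ρ : ℝ, 0 < ρ → ρ ≤ 1 → 𝒦 ⊆ Metric.ball (0 : ℂ) ρ →
        ∀ (M : ℝ) (g : ℂ → ℂ), g ∈ NashFun.U k ρ 𝒦 M →
          ∀ j : ℕ, ‖NashFun.taylorCoeff g j‖ ≤ K * M * (m / ρ) ^ j) := by
  obtain ⟨x, hx, δ, hδ, hdist⟩ := NashFun.exists_separated_points hcard
  refine ⟨fun ρ hρ h𝒦 => ?_, fun m hm => ?_⟩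
  · have hρ0 : 0 < ρ := zero_lt_one.trans hρ
    -- With `r = 1 / ρ` the Cauchy radius `r ρ` is `1`, so no power of `j` remains.
    obtain ⟨K, hK, H⟩ := NashFun.exists_norm_taylorCoeff_le k (inv_pos.2 hρ0)
      (inv_lt_one_of_one_lt₀ hρ) (div_pos hδ hρ0)
    refine ⟨K, hK, fun M g hg j => ?_⟩
    have := H ρ 𝒦 x hρ0 h𝒦 hx
      (fun i j hij => by rw [div_mul_cancel₀ _ hρ0.ne']; exact hdist i j hij) M g hg j
    rwa [inv_mul_cancel₀ hρ0.ne', one_pow, div_one] at this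
  · have hm0 : 0 < m := zero_lt_one.trans hm
    -- With `r = 1 / m` the Cauchy radius is `ρ / m`. Since `ρ ≤ 1` gives `δ ρ ≤ δ`, one `δ`, and
    -- hence one `K`, works for every `ρ`.
    obtain ⟨K, hK, H⟩ := NashFun.exists_norm_taylorCoeff_le k (inv_pos.2 hm0)
      (inv_lt_one_of_one_lt₀ hm) hδ
    refine ⟨K, hK, fun ρ hρ hρ1 h𝒦 M g hg j => ?_⟩
    have := H ρ 𝒦 x hρ h𝒦 hx
      (fun i j hij => (mul_le_of_le_one_right hδ.le hρ1).trans (hdist i j hij)) M g hg j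
    rwa [inv_mul_eq_div, div_eq_mul_inv, ← inv_pow, inv_div] at this
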